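/- Let $(\mathcal{A},\mathbb{E},\mathfrak{s})$ be an extriangulated category in the sense of Nakaoka and Palu (an additive category $\mathcal{A}$, an additive bifunctor $\mathbb{E}:\mathcal{A}^{\mathrm{op}}\times\mathcal{A}\to\mathrm{Ab}$ and an additive realization $\mathfrak{s}$ satisfying (ET3), (ET3)$^{\mathrm{op}}$, (ET4), (ET4)$^{\mathrm{op}}$). An $\mathbb{E}$-triangle $X\xrightarrow{x}L\xrightarrow{y}M\overset{\delta}{\dashrightarrow}$ consists of $\delta\in\mathbb{E}(M,X)$ and a sequence with $\mathfrak{s}(\delta)=[X\xrightarrow{x}L\xrightarrow{y}M]$; then $x$ is called an inflation with cone $M$. A *length function* on $\mathcal{A}$ is a map $\Theta$ from the isomorphism classes of objects of $\mathcal{A}$ to $\mathbb{N}=\{0,1,2,\dots\}$ such that $\Theta(X)=0$ if and only if $X\cong 0$, and such that for every $\mathbb{E}$-triangle $X\to L\to M\overset{\delta}{\dashrightarrow}$ one has $\Theta(L)\le\Theta(X)+\Theta(M)$, with equality if $\delta=0$. An $\mathbb{E}$-triangle $X\xrightarrow{x}L\xrightarrow{y}M\dashrightarrow$ is *$\Theta$-stable*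 if $\Theta(L)=\Theta(X)+\Theta(M)$; in this case $x$ is a *$\Theta$-inflation* and $y$ a *$\Theta$-deflation*. The pair $(\mathcal{A},\Theta)$ is a *length category* if $\Theta$ is a length function and every morphism $f$ of $\mathcal{A}$ factors as $f=j\circ i$ with $i$ a $\Theta$-deflation and $j$ a $\Theta$-inflation; $\mathcal{A}$ is a *length category* if $(\mathcal{A},\Theta)$ is one for some $\Theta$. A *semibrick* is a set $\mathcal{X}$ of isomorphism classes of objects whose endomorphism rings are division rings, with $\operatorname{Hom}(X,Y)=0$ for all non-isomorphic $X,Y\in\mathcal{X}$. It is a *simple-minded system* if every object $M$ of $\mathcal{A}$ has a finite filtration $0=M_0\to M_1\to\cdots\to M_n=M$ by inflations with cones in $\mathcal{X}$. For a length category $(\mathcal{A},\Theta)$, let $\Theta_1$ be the set of isomorphism classes of non-zero objects $M$ with $\Theta(M)\le\Theta(N)$ for all non-zero $N\in\mathcal{A}$. For $n\ge 2$, let $\Theta_n$ be the union of $\Theta_{n-1}$ and the set of isomorphism classes of all $M$ with $\Theta(M)=n$ and $\operatorname{Hom}(X,M)=0=\operatorname{Hom}(M,X)$ for all $X\in\Theta_{n-1}$.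 Put $\Theta_\infty=\bigcup_{n\ge1}\Theta_n$. **Theorem.** The following are equivalent: 1. $\mathcal{A}$ is a length category; 2. $\mathcal{A}$ has a simple-minded system. Moreover, if $(\mathcal{A},\Theta)$ is a length category, then $\Theta_\infty$ is a simple-minded system in $\mathcal{A}$. -/

import Mathlib

open CategoryTheory CategoryTheory.Limits Opposite

universe w v u

/-- An extriangulated structure `(𝔼, 𝔰)` in the sense of Nakaoka and Palu on an additive category
`C`. The correspondence `𝔰`, which sends `δ ∈ 𝔼(Z, X)` to an equivalence class of sequences
`X ⟶ Y ⟶ Z`, is given by the predicate `Realizes x y δ`, "the sequence `(x, y)` belongs to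
`𝔰(δ)`"; the three fields `exists_realizes`, `realizes_of_iso` and `exists_iso_of_realizes` say
that the sequences realizing a given `δ` form exactly one equivalence class. -/
structure ExtriangulatedStructure (C : Type u) [Category.{v} C] [Preadditive C] [HasZeroObject C]
    [HasBinaryBiproducts C] where
  /-- The bifunctor `𝔼 : Cᵒᵖ × C ⥤ Ab`; `(E.obj (op Z)).obj X` is `𝔼(Z, X)`. -/
  E : Cᵒᵖ ⥤ C ⥤ AddCommGrpCat.{w}
  additive_right : ∀ Z : Cᵒᵖ, (E.obj Z).Additive
  additive_left : ∀ X : C, (E.flip.obj X).Additive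
  /-- `Realizes x y δ` means `𝔰(δ) = [X ⟶ Y ⟶ Z]`. -/
  Realizes : ∀ {X Y Z : C}, (X ⟶ Y) → (Y ⟶ Z) → ((E.obj (op Z)).obj X) → Prop
  exists_realizes : ∀ {X Z : C} (δ : (E.obj (op Z)).obj X),
    ∃ (Y : C) (x : X ⟶ Y) (y : Y ⟶ Z), Realizes x y δ
  realizes_of_iso : ∀ {X Y Y' Z : C} {x : X ⟶ Y} {y : Y ⟶ Z} {x' : X ⟶ Y'} {y' : Y' ⟶ Z}
    {δ : (E.obj (op Z)).obj X} (e : Y ≅ Y'), x ≫ e.hom = x' → e.hom ≫ y' = y →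
      Realizes x y δ → Realizes x' y' δ
  exists_iso_of_realizes : ∀ {X Y Y' Z : C} {x : X ⟶ Y} {y : Y ⟶ Z} {x' : X ⟶ Y'} {y' : Y' ⟶ Z}
    {δ : (E.obj (op Z)).obj X}, Realizes x y δ → Realizes x' y' δ →
      ∃ e : Y ≅ Y', x ≫ e.hom = x' ∧ e.hom ≫ y' = y
  /-- `𝔰` is a realization: every morphism of extensions `(a, c) : δ ⟶ δ'`, that is
  `a_* δ = c^* δ'`, lifts to a morphism of realizing sequences. -/
  exists_middle : ∀ {X Y Z X' Y' Z' : C} {x : X ⟶ Y} {y : Y ⟶ Z} {δ : (E.obj (op Z)).obj X}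
    {x' : X' ⟶ Y'} {y' : Y' ⟶ Z'} {δ' : (E.obj (op Z')).obj X'},
    Realizes x y δ → Realizes x' y' δ' → ∀ (a : X ⟶ X') (c : Z ⟶ Z'),
      (E.obj (op Z)).map a δ = (E.map c.op).app X' δ' →
      ∃ b : Y ⟶ Y', x ≫ b = a ≫ x' ∧ b ≫ y' = y ≫ c
  /-- `𝔰(0)` is the class of the split sequence. -/
  realizes_zero : ∀ X Z : C,
    Realizes (biprod.inl : X ⟶ X ⊞ Z) (biprod.snd : X ⊞ Z ⟶ Z) 0
  /-- `𝔰(δ ⊕ δ') = 𝔰(δ) ⊕ 𝔰(δ')`, where `δ ⊕ δ' ∈ 𝔼(Z ⊞ Z', X ⊞ X')` is the extension with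
  components `(δ, 0, 0, δ')`. -/
  realizes_biprod : ∀ {X Y Z X' Y' Z' : C} {x : X ⟶ Y} {y : Y ⟶ Z} {δ : (E.obj (op Z)).obj X}
    {x' : X' ⟶ Y'} {y' : Y' ⟶ Z'} {δ' : (E.obj (op Z')).obj X'},
    Realizes x y δ → Realizes x' y' δ' →
      Realizes (biprod.map x x') (biprod.map y y')
        ((E.obj (op (Z ⊞ Z'))).map (biprod.inl : X ⟶ X ⊞ X')
            ((E.map (biprod.fst : Z ⊞ Z' ⟶ Z).op).app X δ) +
          (E.obj (op (Z ⊞ Z'))).map (biprod.inr : X' ⟶ X ⊞ X')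
            ((E.map (biprod.snd : Z ⊞ Z' ⟶ Z').op).app X' δ'))
  /-- (ET3) -/
  et3 : ∀ {X Y Z X' Y' Z' : C} {x : X ⟶ Y} {y : Y ⟶ Z} {δ : (E.obj (op Z)).obj X}
    {x' : X' ⟶ Y'} {y' : Y' ⟶ Z'} {δ' : (E.obj (op Z')).obj X'},
    Realizes x y δ → Realizes x' y' δ' → ∀ (a : X ⟶ X') (b : Y ⟶ Y'), x ≫ b = a ≫ x' →
      ∃ c : Z ⟶ Z', b ≫ y' = y ≫ c ∧ (E.obj (op Z)).map a δ = (E.map c.op).app X' δ'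
  /-- (ET3)ᵒᵖ -/
  et3_op : ∀ {X Y Z X' Y' Z' : C} {x : X ⟶ Y} {y : Y ⟶ Z} {δ : (E.obj (op Z)).obj X}
    {x' : X' ⟶ Y'} {y' : Y' ⟶ Z'} {δ' : (E.obj (op Z')).obj X'},
    Realizes x y δ → Realizes x' y' δ' → ∀ (b : Y ⟶ Y') (c : Z ⟶ Z'), b ≫ y' = y ≫ c →
      ∃ a : X ⟶ X', x ≫ b = a ≫ x' ∧ (E.obj (op Z)).map a δ = (E.map c.op).app X' δ'
  /-- (ET4) -/
  et4 : ∀ {A B B₁ D F : C} {f : A ⟶ B} {f' : B ⟶ D} {δ : (E.obj (op D)).obj A}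
    {g : B ⟶ B₁} {g' : B₁ ⟶ F} {δ' : (E.obj (op F)).obj B},
    Realizes f f' δ → Realizes g g' δ' →
      ∃ (G : C) (h' : B₁ ⟶ G) (d : D ⟶ G) (e : G ⟶ F) (δ'' : (E.obj (op G)).obj A),
        g ≫ h' = f' ≫ d ∧ h' ≫ e = g' ∧
        Realizes (f ≫ g) h' δ'' ∧
        Realizes d e ((E.obj (op F)).map f' δ') ∧
        (E.map d.op).app A δ'' = δ ∧
        (E.obj (op G)).map f δ'' = (E.map e.op).app B δ'
  /-- (ET4)ᵒᵖ -/
  et4_op : ∀ {A B B₁ D F : C} {f' : D ⟶ A} {f : A ⟶ B} {δ : (E.obj (op B)).obj D}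
    {g' : F ⟶ B} {g : B ⟶ B₁} {δ' : (E.obj (op B₁)).obj F},
    Realizes f' f δ → Realizes g' g δ' →
      ∃ (G : C) (h' : G ⟶ A) (d : D ⟶ G) (e : G ⟶ F) (δ'' : (E.obj (op B₁)).obj G),
        h' ≫ f = e ≫ g' ∧ d ≫ h' = f' ∧
        Realizes h' (f ≫ g) δ'' ∧
        Realizes d e ((E.map g'.op).app D δ) ∧
        (E.obj (op B₁)).map e δ'' = δ' ∧
        (E.obj (op B)).map d δ = (E.map g.op).app G δ''

namespace ExtriangulatedStructure

variable {C : Type u} [Category.{v} C] [Preadditive C] [HasZeroObject C] [HasBinaryBiproducts C]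
  (T : ExtriangulatedStructure.{w} C)

/-- A length function, as an isomorphism-invariant map from the objects of `C` to `ℕ`. -/
structure IsLengthFunction (Θ : C → ℕ) : Prop where
  iso : ∀ {X Y : C}, (X ≅ Y) → Θ X = Θ Y
  eq_zero_iff : ∀ X : C, Θ X = 0 ↔ IsZero X
  le_add : ∀ {X L M : C} {x : X ⟶ L} {y : L ⟶ M} {δ : (T.E.obj (op M)).obj X},
    T.Realizes x y δ → Θ L ≤ Θ X + Θ M
  eq_add_of_split : ∀ {X L M : C} {x : X ⟶ L} {y : L ⟶ M},
    T.Realizes x y 0 → Θ L = Θ X + Θ M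

/-- `x` is a `Θ`-inflation: the first morphism of a `Θ`-stable `𝔼`-triangle. -/
def IsInflationFor (Θ : C → ℕ) {X L : C} (x : X ⟶ L) : Prop :=
  ∃ (M : C) (y : L ⟶ M) (δ : (T.E.obj (op M)).obj X),
    T.Realizes x y δ ∧ Θ L = Θ X + Θ M

/-- `y` is a `Θ`-deflation: the second morphism of a `Θ`-stable `𝔼`-triangle. -/
def IsDeflationFor (Θ : C → ℕ) {L M : C} (y : L ⟶ M) : Prop :=
  ∃ (X : C) (x : X ⟶ L) (δ : (T.E.obj (op M)).obj X),
    T.Realizes x y δ ∧ Θ L = Θ X + Θ M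

/-- `f` is `Θ`-admissible: a `Θ`-deflation followed by a `Θ`-inflation. -/
def IsAdmissibleFor (Θ : C → ℕ) {M N : C} (f : M ⟶ N) : Prop :=
  ∃ (X : C) (i : M ⟶ X) (j : X ⟶ N),
    T.IsDeflationFor Θ i ∧ T.IsInflationFor Θ j ∧ i ≫ j = f

/-- `(C, Θ)` is an extriangulated length category. -/
def IsLengthCategoryWith (Θ : C → ℕ) : Prop :=
  T.IsLengthFunction Θ ∧ ∀ {M N : C} (f : M ⟶ N), T.IsAdmissibleFor Θ f

/-- `C` is an extriangulated length category. -/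
def IsLengthCategory : Prop := ∃ Θ : C → ℕ, T.IsLengthCategoryWith Θ

/-- The objects with a finite filtration `0 = M₀ ⟶ M₁ ⟶ ⋯ ⟶ Mₙ = M` by inflations whose cones
belong to `𝒳`. -/
inductive Filt (𝒳 : ObjectProperty C) : ObjectProperty C
  | zero {M : C} : IsZero M → Filt 𝒳 M
  | step {M M' X : C} {f : M ⟶ M'} {g : M' ⟶ X} {δ : (T.E.obj (op X)).obj M} :
      Filt 𝒳 M → T.Realizes f g δ → 𝒳 X → Filt 𝒳 M'

/-- The endomorphism ring of `X` is a division ring. -/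
def IsBrick (X : C) : Prop :=
  Nontrivial (End X) ∧ ∀ f : End X, f ≠ 0 → IsUnit f

/-- A semibrick; a set of isomorphism classes is an isomorphism-closed property of objects. -/
structure IsSemibrick (𝒳 : ObjectProperty C) : Prop where
  iso_closed : 𝒳.IsClosedUnderIsomorphisms
  brick : ∀ X : C, 𝒳 X → IsBrick X
  hom_eq_zero : ∀ X Y : C, 𝒳 X → 𝒳 Y → IsEmpty (X ≅ Y) → ∀ f : X ⟶ Y, f = 0

/-- A simple-minded system: a semibrick `𝒳` with `C = Filt(𝒳)`. -/
def IsSimpleMindedSystem (𝒳 : ObjectProperty C) : Prop :=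
  IsSemibrick 𝒳 ∧ ∀ M : C, T.Filt 𝒳 M

/-- The sets `Θₙ` for `n ≥ 1` (the value at `0` is a placeholder): `Θ₁` consists of the non-zero
objects of minimal length, and `Θₙ` is the union of `Θₙ₋₁` and the set of objects `M` with
`Θ(M) = n` that have no non-zero morphism to or from an object of `Θₙ₋₁`. -/
def thetaLevel (Θ : C → ℕ) : ℕ → ObjectProperty C
  | 0 => fun _ => False
  | 1 => fun M => ¬ IsZero M ∧ ∀ N : C, ¬ IsZero N → Θ M ≤ Θ N
  | n + 2 => fun M => thetaLevel Θ (n + 1) M ∨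
      ((thetaLevel Θ (n + 1)).rightOrthogonal M ∧ (thetaLevel Θ (n + 1)).leftOrthogonal M ∧
        Θ M = n + 2)

/-- The union `Θ_∞` of the sets `Θₙ`, `n ≥ 1`. -/
def thetaInfty (Θ : C → ℕ) : ObjectProperty C :=
  fun M => ∃ n : ℕ, 1 ≤ n ∧ thetaLevel Θ n M

end ExtriangulatedStructure

/-!
Call a non-zero object of a length category `(C, Θ)` simple if it is not the middle term of a
`Θ`-stable `𝔼`-triangle with non-zero ends. Since every morphism is `Θ`-admissible, a non-zero
morphism between simple objects is invertible, and splitting objects along stable triangles shows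
that every object is filtered by simple objects of at most its own length. An object is therefore
simple as soon as it has no non-zero morphism to a shorter simple object, and it follows that
`Θ_∞` is exactly the class of simple objects.

Conversely, let `𝒳` be a simple-minded system and let `Θ M` be the least length of an
`𝒳`-filtration of `M`. A non-zero morphism `X ⟶ M` with `X` in `𝒳` is an inflation whose cone is
shorter by exactly one, so additivity on split triangles and admissibility of morphisms follow by
induction on the length. For admissibility, objects of `𝒳` are divided out of the source as long
as the morphism kills them; a morphism that kills none is an inflation, because it induces a
morphism of the same kind between the cones of `X ⟶ M` and `X ⟶ M ⟶ N`.
-/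

section Isomorphisms

variable {C : Type u} [Category.{v} C]

lemma isIso_of_isIso_comp_of_isIso_comp {A B : C} (f : A ⟶ B) (g : B ⟶ A) [IsIso (f ≫ g)]
    [IsIso (g ≫ f)] : IsIso f := by
  have : Mono f := mono_of_mono f g
  have : IsSplitEpi f := ⟨⟨inv (g ≫ f) ≫ g, by simp⟩⟩
  exact isIso_of_mono_of_isSplitEpi f

lemma isIso_of_id_sub_comp_self_eq_zero [Preadditive C] {A : C} {f : A ⟶ A}
    (hf : (𝟙 A - f) ≫ (𝟙 A - f) = 0) : IsIso f := by
  let g : End A := 𝟙 A - f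
  have hg : IsNilpotent g := ⟨2, (pow_two g).trans hf⟩
  have hunit : IsUnit (1 - g) := hg.isUnit_one_sub
  have hf : 1 - g = f := sub_sub_cancel (𝟙 A) f
  exact (isUnit_iff_isIso f).1 (hf ▸ hunit)

end Isomorphisms

namespace ExtriangulatedStructure

variable {C : Type u} [Category.{v} C] [Preadditive C] [HasZeroObject C] [HasBinaryBiproducts C]
  {T : ExtriangulatedStructure.{w} C}

section Extensions

variable {X Z Z' : C}

lemma map_op_zero_app (δ : (T.E.obj (op Z')).obj X) :
    (T.E.map (0 : Z ⟶ Z').op).app X δ = 0 := by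
  have := T.additive_left X
  have h : (T.E.flip.obj X).map (0 : Z ⟶ Z').op = 0 := by rw [op_zero, Functor.map_zero]
  simpa using congrArg (fun φ => φ.hom δ) h

lemma map_hom_op_app_map_inv_op_app (e : Z ≅ Z') (δ : (T.E.obj (op Z)).obj X) :
    (T.E.map e.hom.op).app X ((T.E.map e.inv.op).app X δ) = δ := by
  have h : T.E.map e.inv.op ≫ T.E.map e.hom.op = 𝟙 _ := by
    rw [← Functor.map_comp, ← op_comp, e.hom_inv_id, op_id, T.E.map_id]
  exact congrArg (fun φ => φ.app X δ) h

lemma map_op_sub_app (f g : Z ⟶ Z') (δ : (T.E.obj (op Z')).obj X) :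
    (T.E.map (f - g).op).app X δ = (T.E.map f.op).app X δ - (T.E.map g.op).app X δ := by
  have := T.additive_left X
  have h : (T.E.flip.obj X).map (f - g).op =
      (T.E.flip.obj X).map f.op - (T.E.flip.obj X).map g.op := by rw [op_sub, Functor.map_sub]
  simpa using congrArg (fun φ => φ.hom δ) h

lemma extension_eq_zero_of_isZero_left (hX : IsZero X) (δ : (T.E.obj (op Z)).obj X) : δ = 0 := by
  have := T.additive_right (op Z)
  have h : (T.E.obj (op Z)).map (𝟙 X) = 0 := by rw [hX.eq_of_src (𝟙 X) 0, Functor.map_zero]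
  simpa using congrArg (fun φ => φ.hom δ) h

lemma extension_eq_zero_of_isZero_right (hZ : IsZero Z) (δ : (T.E.obj (op Z)).obj X) : δ = 0 := by
  have h := map_op_zero_app (Z := Z) δ
  rw [hZ.eq_of_src 0 (𝟙 Z)] at h
  simpa using h

end Extensions

section Triangles

lemma realizes_of_splitting {S : ShortComplex C} (σ : S.Splitting) : T.Realizes S.f S.g 0 :=
  T.realizes_of_iso σ.isoBinaryBiproduct.symm (by simp) (by ext <;> simp)
    (T.realizes_zero S.X₁ S.X₃)

lemma realizes_of_isZero_left {X L M : C} (hX : IsZero X) (x : X ⟶ L) (y : L ⟶ M) [IsIso y] :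
    T.Realizes x y 0 :=
  realizes_of_splitting (S := .mk x y (hX.eq_of_src _ _)) (.ofIsZeroOfIsIso _ hX ‹_›)

lemma realizes_of_isZero_right {X L M : C} (hM : IsZero M) (x : X ⟶ L) (y : L ⟶ M) [IsIso x] :
    T.Realizes x y 0 :=
  realizes_of_splitting (S := .mk x y (hM.eq_of_tgt _ _)) (.ofIsIsoOfIsZero _ ‹_› hM)

variable {X L M X' L' M' W : C} {x : X ⟶ L} {y : L ⟶ M} {δ : (T.E.obj (op M)).obj X}
  {x' : X' ⟶ L'} {y' : L' ⟶ M'} {δ' : (T.E.obj (op M')).obj X'}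

namespace Realizes

lemma exists_cone_hom {x' : X ⟶ L'} {δ' : (T.E.obj (op M')).obj X} (h : T.Realizes x y δ)
    (h' : T.Realizes x' y' δ') (f : L ⟶ L') (hf : x ≫ f = x') :
    ∃ c : M ⟶ M', f ≫ y' = y ≫ c ∧ δ = (T.E.map c.op).app X δ' := by
  obtain ⟨c, hc, hδ⟩ := T.et3 h h' (𝟙 X) f (by simpa using hf)
  exact ⟨c, hc, by simpa using hδ⟩

lemma exists_desc (h : T.Realizes x y δ) (g : L ⟶ W) (hg : x ≫ g = 0) :
    ∃ c : M ⟶ W, y ≫ c = g := by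
  obtain ⟨c, hc, -⟩ := T.et3 h (realizes_of_isZero_left (isZero_zero C) 0 (𝟙 W)) 0 g (by simp [hg])
  exact ⟨c, by simpa using hc.symm⟩

lemma exists_lift (h : T.Realizes x y δ) (g : W ⟶ L) (hg : g ≫ y = 0) :
    ∃ a : W ⟶ X, a ≫ x = g := by
  obtain ⟨a, ha, -⟩ :=
    T.et3_op (realizes_of_isZero_right (isZero_zero C) (𝟙 W) 0) h g 0 (by simp [hg])
  exact ⟨a, by simpa using ha.symm⟩

lemma comp_eq_zero (h : T.Realizes x y δ) : x ≫ y = 0 := by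
  obtain ⟨c, hc, -⟩ := T.et3 (realizes_of_isZero_right (isZero_zero C) (𝟙 X) 0) h (𝟙 X) x rfl
  simpa using hc

lemma exists_lift_of_map_op_app_eq_zero (h : T.Realizes x y δ) (g : W ⟶ M)
    (hg : (T.E.map g.op).app X δ = 0) : ∃ b : W ⟶ L, b ≫ y = g := by
  obtain ⟨b, -, hb⟩ :=
    T.exists_middle (realizes_of_isZero_left (isZero_zero C) 0 (𝟙 W)) h 0 g (by rw [hg, map_zero])
  exact ⟨b, by simpa using hb⟩

lemma eq_zero_of_section (h : T.Realizes x y δ) (s : M ⟶ L) (hs : s ≫ y = 𝟙 M) : δ = 0 := by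
  obtain ⟨a, -, ha⟩ :=
    T.et3_op (realizes_of_isZero_left (isZero_zero C) 0 (𝟙 M)) h s (𝟙 M) (by simp [hs])
  simpa using ha.symm

lemma exists_splitting_of_section (h : T.Realizes x y δ) (s : M ⟶ L) (hs : s ≫ y = 𝟙 M) :
    ∃ σ : (ShortComplex.mk x y h.comp_eq_zero).Splitting, σ.s = s := by
  obtain rfl := h.eq_zero_of_section s hs
  obtain ⟨e, he, -⟩ := T.exists_iso_of_realizes h (T.realizes_zero X M)
  have : Mono x := mono_of_mono_fac he
  obtain ⟨r, hr⟩ := h.exists_lift (𝟙 L - y ≫ s) (by simp [Preadditive.sub_comp, hs])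
  have hxr : x ≫ r = 𝟙 X := by
    rw [← cancel_mono x, Category.assoc, hr, Preadditive.comp_sub, ← Category.assoc x y,
      h.comp_eq_zero]
    simp
  exact ⟨⟨r, s, hxr, hs, by rw [hr]; simp⟩, rfl⟩

lemma isIso_of_isZero_left (h : T.Realizes x y δ) (hX : IsZero X) : IsIso y := by
  obtain rfl := extension_eq_zero_of_isZero_left hX δ
  obtain ⟨e, -, he⟩ := T.exists_iso_of_realizes h (realizes_of_isZero_left hX 0 (𝟙 M))
  rw [← he]
  infer_instance

lemma isIso_of_isZero_right (h : T.Realizes x y δ) (hM : IsZero M) : IsIso x := by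
  obtain rfl := extension_eq_zero_of_isZero_right hM δ
  obtain ⟨e, he, -⟩ := T.exists_iso_of_realizes (realizes_of_isZero_right hM (𝟙 X) 0) h
  rw [← he]
  infer_instance

lemma isIso_of_middle_endomorphism (h : T.Realizes x y δ) {b : L ⟶ L} (hx : x ≫ b = x)
    (hy : b ≫ y = y) : IsIso b := by
  obtain ⟨c, hc⟩ := h.exists_desc (𝟙 L - b) (by simp [Preadditive.comp_sub, hx])
  have hsq : (𝟙 L - b) ≫ (𝟙 L - b) = 0 := by
    nth_rw 2 [← hc]
    simp [Preadditive.sub_comp, reassoc_of% hy]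
  exact isIso_of_id_sub_comp_self_eq_zero hsq

lemma isIso_of_cone_endomorphism (h : T.Realizes x y δ) {c : M ⟶ M} (hy : y ≫ c = y)
    (hδ : δ = (T.E.map c.op).app X δ) : IsIso c := by
  obtain ⟨b, hb⟩ := h.exists_lift_of_map_op_app_eq_zero (𝟙 M - c) (by
    rw [map_op_sub_app, ← hδ]
    simp)
  have hsq : (𝟙 M - c) ≫ (𝟙 M - c) = 0 := by
    nth_rw 1 [← hb]
    simp [Preadditive.comp_sub, hy]
  exact isIso_of_id_sub_comp_self_eq_zero hsq

lemma nonempty_iso_cone {y' : L ⟶ M'} {δ' : (T.E.obj (op M')).obj X} (h : T.Realizes x y δ)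
    (h' : T.Realizes x y' δ') : Nonempty (M ≅ M') := by
  obtain ⟨c, hc, hδ⟩ := h.exists_cone_hom h' (𝟙 L) (Category.comp_id x)
  obtain ⟨d, hd, hδ'⟩ := h'.exists_cone_hom h (𝟙 L) (Category.comp_id x)
  rw [Category.id_comp] at hc hd
  have : IsIso (c ≫ d) := h.isIso_of_cone_endomorphism
    (by rw [← Category.assoc, ← hc, ← hd]) (by simp [← hδ', ← hδ])
  have : IsIso (d ≫ c) := h'.isIso_of_cone_endomorphism
    (by rw [← Category.assoc, ← hd, ← hc]) (by simp [← hδ', ← hδ])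
  have := isIso_of_isIso_comp_of_isIso_comp c d
  exact ⟨asIso c⟩

lemma exists_middle_iso (h : T.Realizes x y δ) (h' : T.Realizes x' y' δ') (a : X ≅ X')
    (c : M ≅ M') (hδ : (T.E.obj (op M)).map a.hom δ = (T.E.map c.hom.op).app X' δ') :
    ∃ b : L ≅ L', x ≫ b.hom = a.hom ≫ x' ∧ b.hom ≫ y' = y ≫ c.hom := by
  have hδ' : (T.E.obj (op M')).map a.inv δ' = (T.E.map c.inv.op).app X δ := by
    rw [← map_hom_op_app_map_inv_op_app c.symm δ', Iso.symm_hom, Iso.symm_inv, ← hδ]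
    simpa using ((T.E.obj (op M')).mapIso a).hom_inv_id_apply _
  obtain ⟨b, hb, hb'⟩ := T.exists_middle h h' a.hom c.hom hδ
  obtain ⟨d, hd, hd'⟩ := T.exists_middle h' h a.inv c.inv hδ'
  have : IsIso (b ≫ d) := h.isIso_of_middle_endomorphism
    (by simp [reassoc_of% hb, hd]) (by simp [hd', reassoc_of% hb'])
  have : IsIso (d ≫ b) := h'.isIso_of_middle_endomorphism
    (by simp [reassoc_of% hd, hb]) (by simp [hb', reassoc_of% hd'])
  have := isIso_of_isIso_comp_of_isIso_comp b d
  exact ⟨asIso b, hb, hb'⟩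

end Realizes

end Triangles

section Cones

/-- `T.HasCone x M` says that `x` is an inflation with cone `M`. -/
def HasCone (T : ExtriangulatedStructure.{w} C) {X L : C} (x : X ⟶ L) (M : C) : Prop :=
  ∃ (y : L ⟶ M) (δ : (T.E.obj (op M)).obj X), T.Realizes x y δ

variable {X L M L' M' W : C} {x : X ⟶ L} {y : L ⟶ M} {δ : (T.E.obj (op M)).obj X}

lemma Realizes.hasCone (h : T.Realizes x y δ) : T.HasCone x M :=
  ⟨y, δ, h⟩

lemma hasCone_of_isZero (hX : IsZero X) (x : X ⟶ L) : T.HasCone x L :=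
  (realizes_of_isZero_left hX x (𝟙 L)).hasCone

lemma HasCone.isIso_of_isZero (h : T.HasCone x M) (hM : IsZero M) : IsIso x := by
  obtain ⟨y, δ, h⟩ := h
  exact h.isIso_of_isZero_right hM

lemma HasCone.nonempty_iso (h : T.HasCone x M) (h' : T.HasCone x M') : Nonempty (M ≅ M') := by
  obtain ⟨y, δ, h⟩ := h
  obtain ⟨y', δ', h'⟩ := h'
  exact h.nonempty_iso_cone h'

lemma HasCone.of_iso (h : T.HasCone x M) (a : W ≅ X) (c : M ≅ M') :
    T.HasCone (a.hom ≫ x) M' := by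
  obtain ⟨y, δ, h⟩ := h
  obtain ⟨L', x', y', h'⟩ :=
    T.exists_realizes ((T.E.obj (op M')).map a.inv ((T.E.map c.inv.op).app X δ))
  obtain ⟨b, hb, hb'⟩ := h.exists_middle_iso h' a.symm c
    (by simp [map_hom_op_app_map_inv_op_app])
  exact (T.realizes_of_iso (y' := y ≫ c.hom) b.symm (by simp [Iso.comp_inv_eq, hb])
    (by simp [← hb']) h').hasCone

lemma HasCone.comp {Y M₁ M₂ : C} {f : X ⟶ L} {g : L ⟶ Y} (hf : T.HasCone f M₁)
    (hg : T.HasCone g M₂) : ∃ (N : C) (d : M₁ ⟶ N), T.HasCone (f ≫ g) N ∧ T.HasCone d M₂ := by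
  obtain ⟨f', δ, hf⟩ := hf
  obtain ⟨g', δ', hg⟩ := hg
  obtain ⟨N, h, d, e, δ'', -, -, hN, hd, -, -⟩ := T.et4 hf hg
  exact ⟨N, d, hN.hasCone, hd.hasCone⟩

lemma HasCone.comp_inl (h : T.HasCone x M) (Y : C) :
    T.HasCone (x ≫ (biprod.inl : L ⟶ L ⊞ Y)) (M ⊞ Y) := by
  obtain ⟨y, δ, h⟩ := h
  obtain ⟨N, p, d, e, δ', -, -, hN, hd, -, -⟩ := T.et4 h (T.realizes_zero L Y)
  rw [map_zero] at hd
  obtain ⟨c, -, -⟩ := T.exists_iso_of_realizes hd (T.realizes_zero M Y)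
  simpa using hN.hasCone.of_iso (.refl X) c

lemma Realizes.hasCone_of_isIso_comp (h : T.Realizes x y δ) (f : W ⟶ L) [IsIso (f ≫ y)] :
    T.HasCone f X := by
  obtain ⟨σ, hσ⟩ := h.exists_splitting_of_section (inv (f ≫ y) ≫ f) (by simp)
  have hfr : f ≫ σ.r = 0 := by
    have := σ.s_r
    rw [hσ] at this
    simpa using this
  have hid := σ.id
  rw [hσ] at hid
  let τ : (ShortComplex.mk f σ.r hfr).Splitting :=
    ⟨y ≫ inv (f ≫ y), x, by simp [← Category.assoc], σ.f_r, by simpa [add_comm] using hid⟩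
  exact (realizes_of_splitting τ).hasCone

lemma Realizes.exists_middle_hasCone {x' : X ⟶ L'} {y' : L' ⟶ M'}
    {δ' : (T.E.obj (op M')).obj X} (h : T.Realizes x y δ) (h' : T.Realizes x' y' δ') {c : M ⟶ M'}
    (hδ : δ = (T.E.map c.op).app X δ') (hc : T.HasCone c W) :
    ∃ l : L ⟶ L', x ≫ l = x' ∧ l ≫ y' = y ≫ c ∧ T.HasCone l W := by
  obtain ⟨p, η, hc⟩ := hc
  obtain ⟨G, l, d, e, ξ, hle, hdl, hl, hd, -, -⟩ := T.et4_op h' hc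
  rw [← hδ] at hd
  obtain ⟨i, hi, hi'⟩ := T.exists_iso_of_realizes h hd
  refine ⟨i.hom ≫ l, ?_, ?_, hl.hasCone.of_iso i (.refl W)⟩
  · rw [reassoc_of% hi, hdl]
  · rw [Category.assoc, hle, reassoc_of% hi']

end Cones

section Filtrations

/-- The objects with a filtration of exactly `n` steps by inflations whose cones belong to `𝒳`;
it refines `Filt` by the number of steps. -/
inductive FiltN (T : ExtriangulatedStructure.{w} C) (𝒳 : ObjectProperty C) :
    ℕ → ObjectProperty C
  | zero {M : C} : IsZero M → FiltN T 𝒳 0 M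
  | step {n : ℕ} {M M' X : C} {f : M ⟶ M'} :
      FiltN T 𝒳 n M → T.HasCone f X → 𝒳 X → FiltN T 𝒳 (n + 1) M'

variable {𝒳 𝒴 : ObjectProperty C} {m n : ℕ} {X L M N : C}

lemma FiltN.of_iso (hM : T.FiltN 𝒳 n M) (e : M ≅ N) : T.FiltN 𝒳 n N := by
  cases hM with
  | zero h => exact .zero (h.of_iso e.symm)
  | step h hf hX =>
    obtain ⟨g, δ, hf⟩ := hf
    exact .step h (T.realizes_of_iso e rfl (e.hom_inv_id_assoc g) hf).hasCone hX

lemma FiltN.isZero (hM : T.FiltN 𝒳 0 M) : IsZero M := by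
  cases hM with
  | zero h => exact h

lemma FiltN.one (hX : 𝒳 X) : T.FiltN 𝒳 1 X :=
  .step (.zero (isZero_zero C)) (hasCone_of_isZero (isZero_zero C) 0) hX

lemma FiltN.extension {x : X ⟶ L} (hX : T.FiltN 𝒳 m X) (hM : T.FiltN 𝒳 n M)
    (h : T.HasCone x M) : T.FiltN 𝒳 (m + n) L := by
  induction hM generalizing L with
  | zero hM =>
    have := h.isIso_of_isZero hM
    exact hX.of_iso (asIso x)
  | @step _ M₀ _ _ i _ hi hS ih =>
    obtain ⟨y, δ, h⟩ := h
    obtain ⟨L₀, x₀, y₀, h₀⟩ := T.exists_realizes ((T.E.map i.op).app X δ)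
    obtain ⟨l, -, -, hl⟩ := h₀.exists_middle_hasCone h rfl hi
    exact .step (ih h₀.hasCone) hl hS

lemma filt_iff_exists_filtN : T.Filt 𝒳 M ↔ ∃ n, T.FiltN 𝒳 n M := by
  constructor
  · intro h
    induction h with
    | zero h => exact ⟨0, .zero h⟩
    | step _ hr hX ih => exact ⟨_, .step ih.choose_spec hr.hasCone hX⟩
  · rintro ⟨n, h⟩
    induction h with
    | zero h => exact .zero h
    | step _ hf hX ih => exact .step ih hf.choose_spec.choose_spec hX

lemma Filt.of_prop (hX : 𝒳 X) : T.Filt 𝒳 X :=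
  filt_iff_exists_filtN.2 ⟨1, .one hX⟩

lemma Filt.extension {x : X ⟶ L} (hX : T.Filt 𝒳 X) (hM : T.Filt 𝒳 M) (h : T.HasCone x M) :
    T.Filt 𝒳 L := by
  rw [filt_iff_exists_filtN] at hX hM ⊢
  exact ⟨_, hX.choose_spec.extension hM.choose_spec h⟩

lemma Filt.mono (h𝒳 : 𝒳 ≤ 𝒴) (hM : T.Filt 𝒳 M) : T.Filt 𝒴 M := by
  induction hM with
  | zero h => exact .zero h
  | step _ hr hX ih => exact .step ih hr (h𝒳 _ hX)

lemma Filt.hom_eq_zero_of_leftOrthogonal (hM : T.Filt 𝒳 M) (hX : 𝒳.leftOrthogonal X)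
    (f : X ⟶ M) : f = 0 := by
  induction hM with
  | zero h => exact h.eq_of_tgt _ _
  | step _ hr hS ih =>
    obtain ⟨a, rfl⟩ := hr.exists_lift f (hX _ hS)
    rw [ih a, zero_comp]

lemma Filt.hom_eq_zero_of_rightOrthogonal (hM : T.Filt 𝒳 M) (hX : 𝒳.rightOrthogonal X)
    (f : M ⟶ X) : f = 0 := by
  induction hM with
  | zero h => exact h.eq_of_src _ _
  | step _ hr hS ih =>
    obtain ⟨c, rfl⟩ := hr.exists_desc f (ih _)
    rw [hX c hS, comp_zero]

lemma Filt.exists_hom_ne_zero (hM : T.Filt 𝒳 M) (h0 : ¬ IsZero M) :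
    ∃ (X : C) (f : X ⟶ M), 𝒳 X ∧ f ≠ 0 := by
  by_contra! h
  exact h0 ((IsZero.iff_id_eq_zero M).2
    (hM.hom_eq_zero_of_rightOrthogonal (fun X f hX => h X f hX) (𝟙 M)))

/-- The least number of steps of an `𝒳`-filtration of `M`, with value `0` if there is none. It is
the length function that makes `C` a length category when `𝒳` is a simple-minded system. -/
noncomputable def filtLength (T : ExtriangulatedStructure.{w} C) (𝒳 : ObjectProperty C) (M : C) :
    ℕ :=
  sInf {n | T.FiltN 𝒳 n M}

lemma FiltN.filtLength_le (hM : T.FiltN 𝒳 n M) : T.filtLength 𝒳 M ≤ n :=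
  Nat.sInf_le hM

lemma Filt.filtN_filtLength (hM : T.Filt 𝒳 M) : T.FiltN 𝒳 (T.filtLength 𝒳 M) M :=
  Nat.sInf_mem (filt_iff_exists_filtN.1 hM)

lemma filtLength_eq_of_iso (e : M ≅ N) : T.filtLength 𝒳 M = T.filtLength 𝒳 N :=
  congrArg sInf (Set.ext fun _ => ⟨fun h => h.of_iso e, fun h => h.of_iso e.symm⟩)

lemma Filt.filtLength_eq_zero_iff (hM : T.Filt 𝒳 M) : T.filtLength 𝒳 M = 0 ↔ IsZero M :=
  ⟨fun h => (h ▸ hM.filtN_filtLength).isZero,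
    fun h => Nat.le_zero.1 (FiltN.zero h).filtLength_le⟩

lemma Filt.filtLength_le_add {x : X ⟶ L} (hX : T.Filt 𝒳 X) (hM : T.Filt 𝒳 M)
    (h : T.HasCone x M) : T.filtLength 𝒳 L ≤ T.filtLength 𝒳 X + T.filtLength 𝒳 M :=
  (hX.filtN_filtLength.extension hM.filtN_filtLength h).filtLength_le

end Filtrations

section Semibricks

lemma IsBrick.not_isZero {C : Type u} [Category.{v} C] [Preadditive C] {X : C}
    (hX : IsBrick X) : ¬ IsZero X :=
  fun h => have := hX.1; not_subsingleton (End X) ⟨h.eq_of_src⟩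

variable {𝒳 : ObjectProperty C} {X M N : C}

lemma IsSemibrick.isIso_of_ne_zero {C : Type u} [Category.{v} C] [Preadditive C]
    {𝒳 : ObjectProperty C} (h𝒳 : IsSemibrick 𝒳) {X Y : C} (hX : 𝒳 X) (hY : 𝒳 Y) {f : X ⟶ Y}
    (hf : f ≠ 0) : IsIso f := by
  by_cases hXY : IsEmpty (X ≅ Y)
  · exact absurd (h𝒳.hom_eq_zero X Y hX hY hXY f) hf
  · obtain ⟨e⟩ := not_isEmpty_iff.1 hXY
    have hfe : f ≫ e.inv ≠ 0 := fun h => hf (by rw [← cancel_mono e.inv, h, zero_comp])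
    have := (isUnit_iff_isIso (f ≫ e.inv)).1 ((h𝒳.brick X hX).2 _ hfe)
    exact IsIso.of_isIso_comp_right f e.inv

lemma isSemibrick_of_isIso {C : Type u} [Category.{v} C] [Preadditive C] {𝒳 : ObjectProperty C}
    (hiso : 𝒳.IsClosedUnderIsomorphisms) (hzero : ∀ X, 𝒳 X → ¬ IsZero X)
    (hschur : ∀ ⦃X Y : C⦄ (f : X ⟶ Y), 𝒳 X → 𝒳 Y → f ≠ 0 → IsIso f) : IsSemibrick 𝒳 where
  iso_closed := hiso
  brick X hX := by
    refine ⟨⟨𝟙 X, 0, fun h => hzero X hX ((IsZero.iff_id_eq_zero X).2 h)⟩, fun f hf => ?_⟩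
    exact (isUnit_iff_isIso f).2 (hschur f hX hX hf)
  hom_eq_zero X Y hX hY hXY f := by
    by_contra hf
    have := hschur f hX hY hf
    exact hXY.false (asIso f)

lemma FiltN.exists_hasCone_of_ne_zero {n : ℕ} (hM : T.FiltN 𝒳 n M) (h𝒳 : IsSemibrick 𝒳)
    (hX : 𝒳 X) {f : X ⟶ M} (hf : f ≠ 0) :
    ∃ (k : ℕ) (M' : C), n = k + 1 ∧ T.FiltN 𝒳 k M' ∧ T.HasCone f M' := by
  induction hM with
  | zero h => exact absurd (h.eq_of_tgt f 0) hf
  | @step n A _ _ i hA hi hS ih =>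
    obtain ⟨g, δ, hr⟩ := id hi
    by_cases hfg : f ≫ g = 0
    · obtain ⟨a, rfl⟩ := hr.exists_lift f hfg
      obtain ⟨k, N, rfl, hN, ha⟩ := ih (f := a) (fun h => hf (by rw [h, zero_comp]))
      obtain ⟨G, d, hG, hd⟩ := ha.comp hi
      exact ⟨k + 1, G, rfl, .step hN hd hS, hG⟩
    · have := h𝒳.isIso_of_ne_zero hX hS hfg
      exact ⟨n, A, rfl, hA, hr.hasCone_of_isIso_comp f⟩

lemma IsSemibrick.filtLength_eq_one (h𝒳 : IsSemibrick 𝒳) (hX : 𝒳 X) :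
    T.filtLength 𝒳 X = 1 := by
  have hle : T.filtLength 𝒳 X ≤ 1 := (FiltN.one hX).filtLength_le
  have hne : T.filtLength 𝒳 X ≠ 0 :=
    (Filt.of_prop hX).filtLength_eq_zero_iff.not.2 (h𝒳.brick X hX).not_isZero
  omega

lemma Filt.exists_hasCone_of_ne_zero (hM : T.Filt 𝒳 M) (h𝒳 : IsSemibrick 𝒳) (hX : 𝒳 X)
    {f : X ⟶ M} (hf : f ≠ 0) :
    ∃ M' : C, T.HasCone f M' ∧ T.Filt 𝒳 M' ∧ T.filtLength 𝒳 M = 1 + T.filtLength 𝒳 M' := by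
  obtain ⟨k, M', hk, hM', hf'⟩ := hM.filtN_filtLength.exists_hasCone_of_ne_zero h𝒳 hX hf
  have hM'filt : T.Filt 𝒳 M' := filt_iff_exists_filtN.2 ⟨k, hM'⟩
  have hle := (Filt.of_prop hX).filtLength_le_add hM'filt hf'
  rw [h𝒳.filtLength_eq_one hX] at hle
  have := hM'.filtLength_le
  exact ⟨M', hf', hM'filt, by omega⟩

lemma Filt.filtLength_biprod (h𝒳 : IsSemibrick 𝒳) (hM : T.Filt 𝒳 M) (hN : T.Filt 𝒳 N) :
    T.filtLength 𝒳 (M ⊞ N) = T.filtLength 𝒳 M + T.filtLength 𝒳 N := by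
  induction hn : T.filtLength 𝒳 M generalizing M with
  | zero =>
    have := (T.realizes_zero M N).isIso_of_isZero_left (hM.filtLength_eq_zero_iff.1 hn)
    rw [filtLength_eq_of_iso (asIso (biprod.snd : M ⊞ N ⟶ N)), zero_add]
  | succ n ih =>
    have hM0 : ¬ IsZero M := by
      rw [← hM.filtLength_eq_zero_iff]
      omega
    obtain ⟨X, f, hX, hf⟩ := hM.exists_hom_ne_zero hM0
    have hfi : f ≫ (biprod.inl : M ⟶ M ⊞ N) ≠ 0 := fun h =>
      hf (by rw [← cancel_mono (biprod.inl : M ⟶ M ⊞ N), h, zero_comp])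
    have hMN : T.Filt 𝒳 (M ⊞ N) := hM.extension hN (T.realizes_zero M N).hasCone
    obtain ⟨M', hM', hM'filt, hlM'⟩ := hM.exists_hasCone_of_ne_zero h𝒳 hX hf
    obtain ⟨Q, hQ, -, hlQ⟩ := hMN.exists_hasCone_of_ne_zero h𝒳 hX hfi
    obtain ⟨e⟩ := hQ.nonempty_iso (hM'.comp_inl N)
    have hle := filtLength_eq_of_iso (T := T) (𝒳 := 𝒳) e
    have := ih hM'filt (by omega)
    omega

end Semibricks

section SimpleMindedSystems

variable {𝒳 : ObjectProperty C} {M N : C}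

lemma IsSimpleMindedSystem.isLengthFunction_filtLength (h𝒳 : T.IsSimpleMindedSystem 𝒳) :
    T.IsLengthFunction (T.filtLength 𝒳) where
  iso e := filtLength_eq_of_iso e
  eq_zero_iff X := (h𝒳.2 X).filtLength_eq_zero_iff
  le_add h := (h𝒳.2 _).filtLength_le_add (h𝒳.2 _) h.hasCone
  eq_add_of_split {X L M x y} h := by
    obtain ⟨e, -, -⟩ := T.exists_iso_of_realizes h (T.realizes_zero X M)
    rw [filtLength_eq_of_iso e, (h𝒳.2 X).filtLength_biprod h𝒳.1 (h𝒳.2 M)]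

lemma IsDeflationFor.id {Θ : C → ℕ} (hΘ : T.IsLengthFunction Θ) (M : C) :
    T.IsDeflationFor Θ (𝟙 M) :=
  have h := realizes_of_isZero_left (T := T) (isZero_zero C) 0 (𝟙 M)
  ⟨_, _, _, h, hΘ.eq_add_of_split h⟩

lemma IsDeflationFor.comp {Θ : C → ℕ} (hΘ : T.IsLengthFunction Θ) {L M N : C} {y : L ⟶ M}
    {z : M ⟶ N} (hy : T.IsDeflationFor Θ y) (hz : T.IsDeflationFor Θ z) :
    T.IsDeflationFor Θ (y ≫ z) := by
  obtain ⟨K, k, δ, hk, hL⟩ := hy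
  obtain ⟨K', k', δ', hk', hM⟩ := hz
  obtain ⟨G, g, d, e, δ'', -, -, hg, hd, -, -⟩ := T.et4_op hk hk'
  have hLG : Θ L ≤ Θ G + Θ N := hΘ.le_add hg
  have hGK : Θ G ≤ Θ K + Θ K' := hΘ.le_add hd
  exact ⟨G, g, δ'', hg, by omega⟩

/-- `IsMonoFor 𝒳 f` says that `f` is a monomorphism as far as objects of `𝒳` can tell: it kills no
non-zero morphism from an object of `𝒳`. These are the morphisms shown to be inflations when `𝒳` is
a simple-minded system. -/
def IsMonoFor {C : Type u} [Category.{v} C] [HasZeroMorphisms C] (𝒳 : ObjectProperty C) {M N : C}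
    (f : M ⟶ N) : Prop :=
  ∀ ⦃X : C⦄ (g : X ⟶ M), 𝒳 X → g ≫ f = 0 → g = 0

variable {X M' N' : C}

lemma IsMonoFor.cone_hom {f : M ⟶ N} (hf : IsMonoFor 𝒳 f) {x : X ⟶ M} {y : M ⟶ M'}
    {δ : (T.E.obj (op M')).obj X} (h : T.Realizes x y δ) {q : N ⟶ N'}
    {ε : (T.E.obj (op N')).obj X} (h' : T.Realizes (x ≫ f) q ε) {f' : M' ⟶ N'}
    (hff' : f ≫ q = y ≫ f') (hδ : δ = (T.E.map f'.op).app X ε) : IsMonoFor 𝒳 f' := by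
  intro Y g hY hg
  have hgδ : (T.E.map g.op).app X δ = 0 := by
    have : (T.E.map g.op).app X δ = (T.E.map (g ≫ f').op).app X ε := by simp [hδ]
    rw [this, hg, map_op_zero_app]
  obtain ⟨b, rfl⟩ := h.exists_lift_of_map_op_app_eq_zero g hgδ
  obtain ⟨t, ht⟩ := h'.exists_lift (b ≫ f) (by rw [Category.assoc, hff', ← Category.assoc, hg])
  have hb : b - t ≫ x = 0 :=
    hf _ hY (by rw [Preadditive.sub_comp, ← ht, Category.assoc, sub_self])
  rw [sub_eq_zero.1 hb, Category.assoc, h.comp_eq_zero, comp_zero]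

lemma Realizes.exists_iso_comp_eq (hX : IsBrick X) {x' : X ⟶ N} {q : N ⟶ N'}
    {ε : (T.E.obj (op N')).obj X} (h' : T.Realizes x' q ε) (hx' : x' ≠ 0) {x : X ⟶ M}
    {f l : M ⟶ N} (hf : x ≫ f = x') (hl : x ≫ l = x') (hfl : f ≫ q = l ≫ q) :
    ∃ u : M ≅ M, u.hom ≫ l = f := by
  -- `f - l` factors as `d ≫ x'`; as `X` is a brick, `d ≫ x` squares to zero, so take `𝟙 M + d ≫ x`
  obtain ⟨d, hd⟩ := h'.exists_lift (f - l) (by rw [Preadditive.sub_comp, hfl, sub_self])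
  have hxd : x ≫ d = 0 := by
    by_contra hne
    have := (isUnit_iff_isIso (x ≫ d)).1 (hX.2 (x ≫ d) hne)
    refine hx' ((cancel_epi (x ≫ d)).1 ?_)
    rw [Category.assoc, hd, Preadditive.comp_sub, hf, hl, sub_self, comp_zero]
  have : IsIso (𝟙 M + d ≫ x) :=
    isIso_of_id_sub_comp_self_eq_zero (by simp [reassoc_of% hxd])
  exact ⟨asIso (𝟙 M + d ≫ x), by simp [hl, hd]⟩

namespace IsSimpleMindedSystem

lemma isInflationFor_of_isMonoFor (h𝒳 : T.IsSimpleMindedSystem 𝒳) {f : M ⟶ N}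
    (hf : IsMonoFor 𝒳 f) : T.IsInflationFor (T.filtLength 𝒳) f := by
  have hΘ := h𝒳.isLengthFunction_filtLength
  suffices ∃ R, T.HasCone f R ∧ T.filtLength 𝒳 N = T.filtLength 𝒳 M + T.filtLength 𝒳 R by
    obtain ⟨R, ⟨p, η, hp⟩, hR⟩ := this
    exact ⟨R, p, η, hp, hR⟩
  induction hn : T.filtLength 𝒳 M generalizing M N with
  | zero =>
    exact ⟨N, hasCone_of_isZero ((hΘ.eq_zero_iff M).1 hn) f, (zero_add _).symm⟩
  | succ n ih =>
    have hM0 : ¬ IsZero M := by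
      rw [← hΘ.eq_zero_iff]
      omega
    obtain ⟨X, x, hX, hx⟩ := (h𝒳.2 M).exists_hom_ne_zero hM0
    have hxf : x ≫ f ≠ 0 := fun h0 => hx (hf x hX h0)
    obtain ⟨M', ⟨y, δ, h⟩, -, hM'⟩ := (h𝒳.2 M).exists_hasCone_of_ne_zero h𝒳.1 hX hx
    obtain ⟨N', ⟨q, ε, h'⟩, -, hN'⟩ := (h𝒳.2 N).exists_hasCone_of_ne_zero h𝒳.1 hX hxf
    obtain ⟨f', hff', hδ⟩ := h.exists_cone_hom h' f rfl
    obtain ⟨R, hf'R, hR⟩ := ih (hf.cone_hom h h' hff' hδ) (by omega)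
    obtain ⟨l, hxl, hlq, hlR⟩ := h.exists_middle_hasCone h' hδ hf'R
    obtain ⟨u, rfl⟩ := h'.exists_iso_comp_eq (h𝒳.1.brick X hX) hxf rfl hxl (hff'.trans hlq.symm)
    exact ⟨R, hlR.of_iso u (.refl R), by omega⟩

lemma isAdmissibleFor_filtLength (h𝒳 : T.IsSimpleMindedSystem 𝒳) (f : M ⟶ N) :
    T.IsAdmissibleFor (T.filtLength 𝒳) f := by
  have hΘ := h𝒳.isLengthFunction_filtLength
  induction hn : T.filtLength 𝒳 M using Nat.strong_induction_on generalizing M with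
  | _ n ih =>
    by_cases hf : IsMonoFor 𝒳 f
    · exact ⟨M, 𝟙 M, f, .id hΘ M, h𝒳.isInflationFor_of_isMonoFor hf, Category.id_comp f⟩
    · simp only [IsMonoFor, not_forall] at hf
      obtain ⟨X, x, hX, hxf, hx⟩ := hf
      obtain ⟨M', ⟨y, δ, h⟩, -, hM'⟩ := (h𝒳.2 M).exists_hasCone_of_ne_zero h𝒳.1 hX hx
      obtain ⟨f', rfl⟩ := h.exists_desc f hxf
      obtain ⟨I, i, j, hi, hj, rfl⟩ := ih _ (by omega) f' rfl
      have hy : T.IsDeflationFor (T.filtLength 𝒳) y :=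
        ⟨X, x, δ, h, by rw [hM', h𝒳.1.filtLength_eq_one hX]⟩
      exact ⟨I, y ≫ i, j, hy.comp hΘ hi, hj, Category.assoc _ _ _⟩

lemma isLengthCategoryWith_filtLength (h𝒳 : T.IsSimpleMindedSystem 𝒳) :
    T.IsLengthCategoryWith (T.filtLength 𝒳) :=
  ⟨h𝒳.isLengthFunction_filtLength, fun f => h𝒳.isAdmissibleFor_filtLength f⟩

end IsSimpleMindedSystem

end SimpleMindedSystems

section Simples

/-- The simple objects of a length category: `X` is non-zero and is not the middle term of a
`Θ`-stable `𝔼`-triangle with non-zero ends. -/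
def IsSimpleFor (T : ExtriangulatedStructure.{w} C) (Θ : C → ℕ) : ObjectProperty C := fun X =>
  ¬ IsZero X ∧ ∀ ⦃K I : C⦄ ⦃k : K ⟶ X⦄ ⦃i : X ⟶ I⦄ ⦃δ : (T.E.obj (op I)).obj K⦄,
    T.Realizes k i δ → Θ X = Θ K + Θ I → IsZero K ∨ IsZero I

variable {Θ : C → ℕ} {X Y M : C}

lemma IsSimpleFor.isIso_of_isDeflationFor (hX : T.IsSimpleFor Θ X) {i : X ⟶ M}
    (hi : T.IsDeflationFor Θ i) (h0 : i ≠ 0) : IsIso i := by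
  obtain ⟨K, k, δ, hr, hl⟩ := hi
  rcases hX.2 hr hl with hK | hM
  · exact hr.isIso_of_isZero_left hK
  · exact absurd (hM.eq_of_tgt i 0) h0

lemma IsSimpleFor.isIso_of_isInflationFor (hX : T.IsSimpleFor Θ X) {j : M ⟶ X}
    (hj : T.IsInflationFor Θ j) (h0 : j ≠ 0) : IsIso j := by
  obtain ⟨I, i, δ, hr, hl⟩ := hj
  rcases hX.2 hr hl with hM | hI
  · exact absurd (hM.eq_of_src j 0) h0
  · exact hr.isIso_of_isZero_right hI

lemma IsSimpleFor.isIso_of_ne_zero (hX : T.IsSimpleFor Θ X) (hY : T.IsSimpleFor Θ Y) {f : X ⟶ Y}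
    (hf : T.IsAdmissibleFor Θ f) (h0 : f ≠ 0) : IsIso f := by
  obtain ⟨I, i, j, hi, hj, rfl⟩ := hf
  have := hX.isIso_of_isDeflationFor hi (fun h => h0 (by rw [h, zero_comp]))
  have := hY.isIso_of_isInflationFor hj (fun h => h0 (by rw [h, comp_zero]))
  infer_instance

lemma IsSimpleFor.of_iso (hΘ : T.IsLengthFunction Θ) (e : X ≅ Y) (hX : T.IsSimpleFor Θ X) :
    T.IsSimpleFor Θ Y :=
  ⟨fun h => hX.1 (h.of_iso e), fun _ _ _ i _ hr hl =>
    hX.2 (T.realizes_of_iso e.symm rfl (e.inv_hom_id_assoc i) hr) ((hΘ.iso e).trans hl)⟩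

lemma filt_isSimpleFor (hΘ : T.IsLengthFunction Θ) {n : ℕ} (hM : Θ M < n) :
    T.Filt (fun S => T.IsSimpleFor Θ S ∧ Θ S < n) M := by
  induction hm : Θ M using Nat.strong_induction_on generalizing M with
  | _ m ih =>
    subst hm
    by_cases hM0 : IsZero M
    · exact .zero hM0
    by_cases hMs : T.IsSimpleFor Θ M
    · exact .of_prop ⟨hMs, hM⟩
    · simp only [IsSimpleFor, not_and, not_forall, not_or] at hMs
      obtain ⟨K, I, k, i, δ, hr, hl, hK, hI⟩ := hMs hM0
      rw [← hΘ.eq_zero_iff] at hK hI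
      exact (ih (Θ K) (by omega) (by omega) rfl).extension (ih (Θ I) (by omega) (by omega) rfl)
        hr.hasCone

lemma isSimpleMindedSystem_isSimpleFor (hΘ : T.IsLengthCategoryWith Θ) :
    T.IsSimpleMindedSystem (T.IsSimpleFor Θ) := by
  refine ⟨isSemibrick_of_isIso ⟨fun e => .of_iso hΘ.1 e⟩ (fun X hX => hX.1)
    (fun X Y f hX hY => hX.isIso_of_ne_zero hY (hΘ.2 f)), fun M => ?_⟩
  exact (filt_isSimpleFor hΘ.1 (Nat.lt_succ_self (Θ M))).mono fun S hS => hS.1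

lemma isSimpleFor_of_leftOrthogonal (hΘ : T.IsLengthFunction Θ) (hX0 : ¬ IsZero X)
    (hX : ObjectProperty.leftOrthogonal (fun S => T.IsSimpleFor Θ S ∧ Θ S < Θ X) X) :
    T.IsSimpleFor Θ X := by
  refine ⟨hX0, fun K I k i δ hr hl => ?_⟩
  by_contra! h
  rw [← hΘ.eq_zero_iff, ← hΘ.eq_zero_iff] at h
  have hi : i = 0 :=
    (filt_isSimpleFor hΘ (show Θ I < Θ X by omega)).hom_eq_zero_of_leftOrthogonal hX i
  obtain ⟨s, hs⟩ := hr.exists_lift (𝟙 X) (by rw [hi, comp_zero])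
  have hs0 : s = 0 :=
    (filt_isSimpleFor hΘ (show Θ K < Θ X by omega)).hom_eq_zero_of_leftOrthogonal hX s
  exact hX0 ((IsZero.iff_id_eq_zero X).2 (by rw [← hs, hs0, zero_comp]))

lemma isSimpleFor_of_thetaLevel_one (hΘ : T.IsLengthFunction Θ) (hX : thetaLevel Θ 1 X) :
    T.IsSimpleFor Θ X := by
  refine isSimpleFor_of_leftOrthogonal hΘ hX.1 fun S f hS => ?_
  exact absurd (hX.2 S hS.1.1) hS.2.not_ge

lemma thetaLevel_succ_iff (hΘ : T.IsLengthCategoryWith Θ) (n : ℕ) (X : C) :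
    thetaLevel Θ (n + 1) X ↔
      T.IsSimpleFor Θ X ∧ (Θ X ≤ n + 1 ∨ ∀ N : C, ¬ IsZero N → Θ X ≤ Θ N) := by
  induction n generalizing X with
  | zero =>
    refine ⟨fun hX => ⟨isSimpleFor_of_thetaLevel_one hΘ.1 hX, .inr hX.2⟩, fun ⟨hXs, hX⟩ =>
      ⟨hXs.1, fun N hN => ?_⟩⟩
    rcases hX with hX | hX
    · rw [← hΘ.1.eq_zero_iff] at hN
      omega
    · exact hX N hN
  | succ n ih =>
    constructor
    · rintro (hX | ⟨-, hX, hXn⟩)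
      · exact ⟨((ih X).1 hX).1, ((ih X).1 hX).2.imp_left (by omega)⟩
      · have hX0 : ¬ IsZero X := by
          rw [← hΘ.1.eq_zero_iff]
          omega
        exact ⟨isSimpleFor_of_leftOrthogonal hΘ.1 hX0
          fun S f hS => hX f ((ih S).2 ⟨hS.1, .inl (by omega)⟩), .inl hXn.le⟩
    · rintro ⟨hXs, hX⟩
      by_cases hXn : Θ X ≤ n + 1 ∨ ∀ N : C, ¬ IsZero N → Θ X ≤ Θ N
      · exact .inl ((ih X).2 ⟨hXs, hXn⟩)
      have hne : ∀ S, thetaLevel Θ (n + 1) S → IsEmpty (S ≅ X) := fun S hS =>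
        ⟨fun e => hXn (hΘ.1.iso e ▸ ((ih S).1 hS).2)⟩
      have hΘX : Θ X = n + 2 := le_antisymm (hX.resolve_right fun h => hXn (.inr h))
        (not_le.1 fun h => hXn (.inl h))
      have hsb := (isSimpleMindedSystem_isSimpleFor hΘ).1
      exact .inr ⟨fun S f hS => hsb.hom_eq_zero S X ((ih S).1 hS).1 hXs (hne S hS) f,
        fun S f hS => hsb.hom_eq_zero X S hXs ((ih S).1 hS).1 ⟨fun e => (hne S hS).false e.symm⟩ f,
        hΘX⟩

lemma thetaInfty_eq_isSimpleFor (hΘ : T.IsLengthCategoryWith Θ) :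
    thetaInfty Θ = T.IsSimpleFor Θ := by
  ext X
  constructor
  · rintro ⟨n, hn, hX⟩
    obtain ⟨n, rfl⟩ := Nat.exists_eq_add_of_le' hn
    exact ((thetaLevel_succ_iff hΘ n X).1 hX).1
  · intro hX
    exact ⟨Θ X + 1, by omega, (thetaLevel_succ_iff hΘ (Θ X) X).2 ⟨hX, .inl (Nat.le_succ _)⟩⟩

end Simples

end ExtriangulatedStructure

theorem theorem3 {C : Type u} [Category.{v} C] [Preadditive C] [HasZeroObject C]
    [HasBinaryBiproducts C] (T : ExtriangulatedStructure.{w} C) :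
    (T.IsLengthCategory ↔ ∃ 𝒳 : ObjectProperty C, T.IsSimpleMindedSystem 𝒳) ∧
      ∀ Θ : C → ℕ, T.IsLengthCategoryWith Θ →
        T.IsSimpleMindedSystem (ExtriangulatedStructure.thetaInfty Θ) := by
  have hthetaInfty : ∀ Θ : C → ℕ, T.IsLengthCategoryWith Θ →
      T.IsSimpleMindedSystem (ExtriangulatedStructure.thetaInfty Θ) := by
    intro Θ hΘ
    rw [ExtriangulatedStructure.thetaInfty_eq_isSimpleFor hΘ]
    exact ExtriangulatedStructure.isSimpleMindedSystem_isSimpleFor hΘ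
  refine ⟨⟨?_, ?_⟩, hthetaInfty⟩
  · rintro ⟨Θ, hΘ⟩
    exact ⟨ExtriangulatedStructure.thetaInfty Θ, hthetaInfty Θ hΘ⟩
  · rintro ⟨𝒳, h𝒳⟩
    exact ⟨T.filtLength 𝒳, h𝒳.isLengthCategoryWith_filtLength⟩
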